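/- Let $K_n$ be the complete graph on $n$ vertices. For integers $r\ge 1$, $\ell\ge 1$ and a finite graph $G$ with at least two vertices, let $\kappa_{r,\ell}(G)$ (the alternating connectivity of $G$) be the maximum $t$ such that there is a (not necessarily proper) coloring of the edges of $G$ with $r$ colors for which any two distinct vertices of $G$ are connected by $t$ pairwise internally disjoint alternating paths of length $\ell$. Here the length of a path is its number of edges, a path is alternating if any two of its adjacent edges have different colors, and two paths with the same end vertices are internally disjoint if they have no other vertex in common. Then for every fixed integer $r\ge 2$, as $n\to\infty$, $$\kappa_{r,2}(K_n)\sim\Bigl(1-\frac1r\Bigr)n,$$ and for every fixed integer $\ell\ge 3$, as $n\to\infty$, $$\kappa_{r,\ell}(K_n)\sim\frac{n}{\ell-1},$$ where $a_n\sim b_n$ means $\lim_{n\to\infty}a_n/b_n=1$. -/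

import Mathlib

namespace AltConn

open SimpleGraph

variable {V K : Type*} {G : SimpleGraph V}

/-- The sequence of colors of the edges traversed by a walk, in order. -/
def colors (c : G.EdgeLabeling K) : {u v : V} → G.Walk u v → List K
  | _, _, .nil => []
  | _, _, .cons h p => c.get _ _ h :: colors c p

/-- A walk is alternating if any two consecutive edges have different colors. -/
def IsAlternating (c : G.EdgeLabeling K) {u v : V} (p : G.Walk u v) : Prop :=
  (colors c p).IsChain (· ≠ ·)

/-- Two paths with the same ends are internally disjoint if they share no vertex except the ends. -/
def InternallyDisjoint {u v : V} (p q : G.Path u v) : Prop :=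
  ∀ w, w ∈ p.1.support → w ∈ q.1.support → w = u ∨ w = v

/-- Under the edge coloring `c`, the vertices `u` and `v` are connected by `t` (distinct) pairwise
internally disjoint alternating paths of length `l`. -/
def ConnectedBy (c : G.EdgeLabeling K) (l t : ℕ) (u v : V) : Prop :=
  ∃ P : Finset (G.Path u v), P.card = t ∧
    (∀ p ∈ P, p.1.length = l ∧ IsAlternating c p.1) ∧
    ∀ p ∈ P, ∀ q ∈ P, p ≠ q → InternallyDisjoint p q

/-- The numbers `t` for which some (not necessarily proper) `r`-edge-coloring of `G` connects every
pair of distinct vertices by `t` internally disjoint alternating paths of length `l`. -/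
def achievable (r l : ℕ) (G : SimpleGraph V) : Set ℕ :=
  {t | ∃ c : G.EdgeLabeling (Fin r), ∀ u v : V, u ≠ v → ConnectedBy c l t u v}

/-- The alternating connectivity of `G` for `r` colors and paths of length `l`. -/
noncomputable def alternatingConnectivity (r l : ℕ) (G : SimpleGraph V) : ℕ :=
  sSup (achievable r l G)

/-- The supremum is a maximum for every finite graph with at least two vertices, `r ≥ 1`. -/
theorem isGreatest_alternatingConnectivity [Finite V] [Nontrivial V] {r : ℕ} (hr : 1 ≤ r) (l : ℕ)
    (G : SimpleGraph V) : IsGreatest (achievable r l G) (alternatingConnectivity r l G) := by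
  classical
  have hne : (achievable r l G).Nonempty :=
    ⟨0, fun _ => ⟨0, hr⟩, fun u v _ => ⟨∅, by simp, by simp, by simp⟩⟩
  have hbdd : BddAbove (achievable r l G) := by
    cases nonempty_fintype V
    obtain ⟨u, v, huv⟩ := exists_pair_ne V
    refine ⟨Fintype.card (G.Path u v), ?_⟩
    rintro t ⟨c, hc⟩
    obtain ⟨P, rfl, -⟩ := hc u v huv
    exact P.card_le_univ
  exact ⟨Nat.sSup_mem hne hbdd, fun t ht => le_csSup hbdd ht⟩

end AltConn

/-!
In a uniformly random coloring, Hoeffding's inequality and a union bound show that, for any two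
vertices `u`, `v` and colors `i`, `j`, about `n / r ^ 2` vertices are joined to `u` in color `i` and
to `v` in color `j`. Summing over `i ≠ j` gives the lower bound for `ℓ = 2`. It is optimal because
among the pairs of edges at a vertex at most a fraction `1 - 1 / r` have different colors, by the
Cauchy–Schwarz inequality.

For `ℓ ≥ 3` the `ℓ - 1` inner vertices of each path are disjoint from those of the others, which
gives the upper bound. For the lower bound two colors suffice: the balance of the joint color
classes is a second-moment condition forcing edges of both colors between any two sets that are not
of size `o(n)`. For each color `a` of the first edge, choose among the neighbors of `u` in color `a`
disjoint sets of nearly `n / (2 * (ℓ - 1))` vertices, one for each position on the path, the last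
one inside the neighborhood of `v` in the color required of the last edge, and extract alternating
paths through these sets greedily until only `o(n)` vertices remain in each.
-/

namespace AltConn

open SimpleGraph
open Finset hiding card

section Walks

variable {V K : Type*} {G : SimpleGraph V} {u v : V}

/-- The edge labeling of a graph induced by a coloring of all pairs of vertices. Colorings of
`Sym2 V` avoid carrying adjacency proofs; their values off the edges of `G` are irrelevant. -/
def labelingOfSym2 (G : SimpleGraph V) (C : Sym2 V → K) : G.EdgeLabeling K :=
  fun e => C e

theorem exists_labelingOfSym2_eq [Nonempty K] (c : G.EdgeLabeling K) :
    ∃ C : Sym2 V → K, labelingOfSym2 G C = c :=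
  ⟨Function.extend Subtype.val c fun _ => Classical.arbitrary K,
    funext fun e => Subtype.val_injective.extend_apply _ _ e⟩

theorem colors_labelingOfSym2 (C : Sym2 V → K) (p : G.Walk u v) :
    colors (labelingOfSym2 G C) p = p.edges.map C := by
  induction p with
  | nil => rfl
  | cons h p ih => simp only [colors, ih, Walk.edges_cons, List.map_cons]; rfl

theorem colors_compRight {K' : Type*} (c : G.EdgeLabeling K) (f : K → K') (p : G.Walk u v) :
    colors (c.compRight f) p = (colors c p).map f := by
  induction p with
  | nil => rfl
  | cons h p ih => simp only [colors, ih, List.map_cons]; rfl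

theorem ConnectedBy.compRight {K' : Type*} {c : G.EdgeLabeling K} {f : K → K'}
    (hf : f.Injective) {l t : ℕ} (h : ConnectedBy c l t u v) :
    ConnectedBy (c.compRight f) l t u v := by
  obtain ⟨P, hcard, halt, hdisj⟩ := h
  refine ⟨P, hcard, fun p hp => ⟨(halt p hp).1, ?_⟩, hdisj⟩
  rw [IsAlternating, colors_compRight, List.isChain_map]
  exact (halt p hp).2.imp fun _ _ => hf.ne

theorem mem_achievable_of_connectedBy [Fintype K] {r l t : ℕ} (hK : Fintype.card K ≤ r)
    (c : G.EdgeLabeling K) (h : ∀ u v, u ≠ v → ConnectedBy c l t u v) : t ∈ achievable r l G :=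
  have ⟨f⟩ : Nonempty (K ↪ Fin r) := Function.Embedding.nonempty_of_card_le (by simpa using hK)
  ⟨c.compRight f, fun u v huv => (h u v huv).compRight f.injective⟩

theorem exists_walk_of_forall_adj {n : ℕ} {f : Fin (n + 1) → V}
    (h : ∀ i : Fin n, G.Adj (f i.castSucc) (f i.succ)) :
    ∃ p : G.Walk (f 0) (f (Fin.last n)),
      p.support = List.ofFn f ∧ p.edges = List.ofFn fun i : Fin n => s(f i.castSucc, f i.succ) := by
  induction n with
  | zero => exact ⟨.nil, by simp, by simp⟩
  | succ n ih =>
    obtain ⟨p, hsupport, hedges⟩ := ih (f := f ∘ Fin.succ) fun i => h i.succ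
    have hadj : G.Adj (f 0) (f (Fin.succ 0)) := h 0
    refine ⟨.cons hadj p, ?_, ?_⟩
    · rw [Walk.support_cons, hsupport, List.ofFn_succ (f := f)]
      rfl
    · rw [Walk.edges_cons, hedges, List.ofFn_succ (n := n)]
      rfl

end Walks

section DisjointSequences

variable {V K : Type*} {u v : V} {C : Sym2 V → K} {d : ℕ}

/-- The sequence `x` preceded by `u` and followed by `v`: the vertices of a path from `u` to `v`
with interior `x`. -/
def withEnds (u v : V) (x : Fin d → V) : Fin (d + 2) → V :=
  Fin.cons u (Fin.snoc x v : Fin (d + 1) → V)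

theorem exists_path_of_withEnds {x : Fin d → V} (huv : u ≠ v) (hinj : x.Injective)
    (hu : u ∉ Set.range x) (hv : v ∉ Set.range x)
    (halt : ∀ i : Fin d, C s(withEnds u v x i.castSucc.castSucc, withEnds u v x i.castSucc.succ) ≠
      C s(withEnds u v x i.succ.castSucc, withEnds u v x i.succ.succ)) :
    ∃ p : (⊤ : SimpleGraph V).Path u v, p.1.length = d + 1 ∧
      IsAlternating (labelingOfSym2 ⊤ C) p.1 ∧
      ∀ w, w ∈ p.1.support ↔ w = u ∨ w = v ∨ w ∈ Set.range x := by
  have hf : (withEnds u v x).Injective := by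
    simp [withEnds, Fin.cons_injective_iff, Fin.snoc_injective_iff, Fin.range_snoc, *]
  obtain ⟨p, hsupport, hedges⟩ := exists_walk_of_forall_adj (G := ⊤) (f := withEnds u v x)
    fun i => (top_adj _ _).2 (hf.ne (Fin.castSucc_lt_succ).ne)
  have hzero : withEnds u v x 0 = u := rfl
  have hlast : withEnds u v x (Fin.last _) = v := by
    rw [withEnds, ← Fin.succ_last, Fin.cons_succ, Fin.snoc_last]
  refine ⟨⟨p.copy hzero hlast, ?_⟩, ?_, ?_, fun w => ?_⟩
  · rw [Walk.isPath_copy, Walk.isPath_def, hsupport]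
    exact List.nodup_ofFn.2 hf
  · rw [Walk.length_copy, ← Walk.length_edges, hedges, List.length_ofFn]
  · rw [IsAlternating, colors_labelingOfSym2, Walk.edges_copy, hedges, List.map_ofFn,
      List.isChain_ofFn]
    exact fun i hi => halt ⟨i, by omega⟩
  · rw [Walk.support_copy, hsupport, List.mem_ofFn, ← Set.mem_range, withEnds, Fin.range_cons,
      Fin.range_snoc]
    simp

theorem connectedBy_of_injective {ι : Type*} [Fintype ι] {x : ι → Fin (d + 1) → V} (huv : u ≠ v)
    (hinj : (Function.uncurry x).Injective) (hu : ∀ j, u ∉ Set.range (x j))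
    (hv : ∀ j, v ∉ Set.range (x j))
    (halt : ∀ j (i : Fin (d + 1)),
      C s(withEnds u v (x j) i.castSucc.castSucc, withEnds u v (x j) i.castSucc.succ) ≠
        C s(withEnds u v (x j) i.succ.castSucc, withEnds u v (x j) i.succ.succ)) :
    ConnectedBy (labelingOfSym2 ⊤ C) (d + 2) (Fintype.card ι) u v := by
  classical
  have hpath (j) := exists_path_of_withEnds huv (hinj.comp (Prod.mk_right_injective j))
    (hu j) (hv j) (halt j)
  choose p hlength halternating hsupport using hpath
  have hdisjoint {j j' : ι} (hne : j ≠ j') : InternallyDisjoint (p j) (p j') := by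
    intro w hw hw'
    rw [hsupport] at hw hw'
    obtain rfl | rfl | ⟨i, rfl⟩ := hw
    · exact .inl rfl
    · exact .inr rfl
    obtain h | h | ⟨i', h⟩ := hw'
    · exact .inl h
    · exact .inr h
    · exact absurd (congrArg Prod.fst (@hinj (j', i') (j, i) h)).symm hne
  have hp : p.Injective := by
    intro j j' h
    by_contra hne
    have hmem : x j 0 ∈ (p j).1.support := (hsupport j _).2 (.inr (.inr ⟨0, rfl⟩))
    rcases hdisjoint hne _ hmem (h ▸ hmem) with h0 | h0
    · exact hu j ⟨0, h0⟩
    · exact hv j ⟨0, h0⟩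
  refine ⟨univ.map ⟨p, hp⟩, by simp, by simp [*], ?_⟩
  simp only [mem_map, mem_univ, true_and, forall_exists_index, forall_apply_eq_imp_iff]
  exact fun j j' hne => hdisjoint (mt (congrArg p) hne)

end DisjointSequences

section Interior

variable {V K : Type*} [DecidableEq V] {G : SimpleGraph V} {u v : V}

/-- The set of inner vertices of a path. -/
def interior (p : G.Path u v) : Finset V :=
  p.1.support.toFinset \ {u, v}

theorem card_interior (huv : u ≠ v) (p : G.Path u v) : #(interior p) = p.1.length - 1 := by
  have hends : {u, v} ⊆ p.1.support.toFinset := by simp [insert_subset_iff]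
  rw [interior, card_sdiff_of_subset hends, List.toFinset_card_of_nodup p.2.support_nodup,
    Walk.length_support, card_pair huv]
  omega

theorem InternallyDisjoint.disjoint_interior {p q : G.Path u v} (h : InternallyDisjoint p q) :
    Disjoint (interior p) (interior q) := by
  refine Finset.disjoint_left.2 fun w hp hq => ?_
  simp only [interior, mem_sdiff, List.mem_toFinset, mem_insert, mem_singleton] at hp hq
  exact hp.2 (h w hp.1 hq.1)

theorem ConnectedBy.mul_le_card {c : G.EdgeLabeling K} {l t : ℕ} (h : ConnectedBy c l t u v)
    (huv : u ≠ v) {S : Finset V}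
    (hS : ∀ p : G.Path u v, p.1.length = l → IsAlternating c p.1 → interior p ⊆ S) :
    t * (l - 1) ≤ #S := by
  obtain ⟨P, rfl, halt, hdisj⟩ := h
  have hcard : #(P.biUnion interior) = #P * (l - 1) := by
    rw [card_biUnion fun p hp q hq hne => (hdisj p hp q hq hne).disjoint_interior,
      sum_const_nat fun p hp => by rw [card_interior huv, (halt p hp).1]]
  rw [← hcard]
  exact card_le_card (biUnion_subset.2 fun p hp => hS p (halt p hp).1 (halt p hp).2)

end Interior

section BichromaticCenters

variable {V K : Type*} [Fintype V] [DecidableEq V] [DecidableEq K] {C : Sym2 V → K} {u v : V}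

/-- The vertices `w` outside `u`, `v` for which the path `u`, `w`, `v` has two colors. -/
def bichromaticCenters (C : Sym2 V → K) (u v : V) : Finset V :=
  {w | (w ≠ u ∧ w ≠ v) ∧ C s(u, w) ≠ C s(v, w)}

theorem ConnectedBy.le_card_bichromaticCenters {G : SimpleGraph V} {t : ℕ} (huv : u ≠ v)
    (h : ConnectedBy (labelingOfSym2 G C) 2 t u v) : t ≤ #(bichromaticCenters C u v) := by
  refine (mul_one t).ge.trans (h.mul_le_card huv ?_)
  rintro ⟨p, hp⟩ hlength halt w hw
  rw [IsAlternating, colors_labelingOfSym2] at halt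
  match p with
  | .cons (v := z) h₁ (.cons h₂ .nil) =>
    have hne : C s(u, z) ≠ C s(z, v) := by simpa using halt
    have hwz : w = z ∧ w ≠ u ∧ w ≠ v := by
      simp only [interior, mem_sdiff, List.mem_toFinset, Walk.support_cons, Walk.support_nil,
        List.mem_cons, List.not_mem_nil, mem_insert, mem_singleton] at hw
      grind
    obtain ⟨rfl, hends⟩ := hwz
    exact mem_filter.2 ⟨mem_univ _, hends, by rwa [Sym2.eq_swap (a := v)]⟩

theorem connectedBy_of_le_card_bichromaticCenters (huv : u ≠ v) {t : ℕ}
    (ht : t ≤ #(bichromaticCenters C u v)) : ConnectedBy (labelingOfSym2 ⊤ C) 2 t u v := by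
  obtain ⟨T, hT, rfl⟩ := exists_subset_card_eq ht
  have hmem (w : T) := mem_filter.1 (hT w.2)
  rw [← Fintype.card_coe]
  refine connectedBy_of_injective (x := fun (w : T) _ => w) huv ?_ ?_ ?_ ?_
  · rintro ⟨w, i⟩ ⟨w', i'⟩ h
    exact Prod.ext (Subtype.ext h) (Subsingleton.elim (α := Fin 1) _ _)
  · rintro w ⟨_, h⟩
    exact (hmem w).2.1.1 h
  · rintro w ⟨_, h⟩
    exact (hmem w).2.1.2 h
  · intro w i
    fin_cases i
    have := (hmem w).2.2
    rw [Sym2.eq_swap (a := v)] at this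
    exact this

theorem card_filter_ne_le {α : Type*} [Fintype K] (g : α → K) (S : Finset α) :
    (#{p ∈ S ×ˢ S | g p.1 ≠ g p.2} : ℝ) ≤ (1 - 1 / (Fintype.card K : ℝ)) * (#S : ℝ) ^ 2 := by
  have hfiber (k : K) : #{p ∈ S ×ˢ S | g p.1 = g p.2 ∧ g p.1 = k} = #{a ∈ S | g a = k} ^ 2 := by
    rw [sq, ← card_product, ← filter_product]
    congr 1
    grind
  have heq : #{p ∈ S ×ˢ S | g p.1 = g p.2} = ∑ k, #{a ∈ S | g a = k} ^ 2 := by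
    rw [card_eq_sum_card_fiberwise (f := fun p => g p.1) (t := univ) (by simp)]
    simp_rw [filter_filter, hfiber]
  have hne :
      (#{p ∈ S ×ˢ S | g p.1 = g p.2} : ℝ) + #{p ∈ S ×ˢ S | g p.1 ≠ g p.2} = (#S : ℝ) ^ 2 := by
    rw [sq]
    exact_mod_cast (card_filter_add_card_filter_not _).trans (card_product S S)
  have hcs : (#S : ℝ) ^ 2 ≤ Fintype.card K * #{p ∈ S ×ˢ S | g p.1 = g p.2} := by
    rw [heq, card_eq_sum_card_fiberwise (f := g) (t := univ) (by simp)]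
    exact_mod_cast sq_sum_le_card_mul_sum_sq
  rcases isEmpty_or_nonempty K with hK | hK
  · have : S = ∅ := eq_empty_of_forall_notMem fun a _ => hK.false (g a)
    simp [this]
  have hK : (0 : ℝ) < Fintype.card K := Nat.cast_pos.2 Fintype.card_pos
  have := (div_le_iff₀' hK).2 hcs
  rw [sub_mul, one_mul, one_div_mul_eq_div]
  linarith

theorem sum_card_bichromaticCenters_le [Fintype K] (C : Sym2 V → K) :
    (∑ p ∈ (univ : Finset V).offDiag, #(bichromaticCenters C p.1 p.2) : ℝ) ≤
      Fintype.card V * ((1 - 1 / (Fintype.card K : ℝ)) * (Fintype.card V - 1) ^ 2) := by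
  have hcenter (w : V) : (#{p ∈ univ.offDiag | w ∈ bichromaticCenters C p.1 p.2} : ℝ) ≤
      (1 - 1 / (Fintype.card K : ℝ)) * (Fintype.card V - 1) ^ 2 := by
    have h := card_filter_ne_le (fun u => C s(u, w)) (univ.erase w)
    rw [cast_card_erase_of_mem (mem_univ w), card_univ] at h
    refine le_trans (Nat.cast_le.2 (card_le_card ?_)) h
    intro p hp
    simp only [bichromaticCenters, mem_filter, mem_univ, true_and] at hp
    simp [hp, ne_comm]
  have hcount := sum_card_bipartiteAbove_eq_sum_card_bipartiteBelow
    (s := (univ : Finset V).offDiag) (t := univ) fun p w => w ∈ bichromaticCenters C p.1 p.2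
  simp only [bipartiteAbove, bipartiteBelow, filter_univ_mem] at hcount
  calc
    _ = ∑ w, (#{p ∈ univ.offDiag | w ∈ bichromaticCenters C p.1 p.2} : ℝ) := mod_cast hcount
    _ ≤ _ := by simpa using sum_le_card_nsmul univ _ _ fun w _ => hcenter w

theorem cast_card_offDiag_univ (α : Type*) [Fintype α] :
    (#(univ : Finset α).offDiag : ℝ) = Fintype.card α * (Fintype.card α - 1) := by
  rw [offDiag_card, Nat.cast_sub (Nat.le_mul_self _), card_univ, Nat.cast_mul, mul_sub_one]

theorem le_of_forall_le_card_bichromaticCenters [Fintype K] [Nontrivial V] {t : ℕ}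
    (h : ∀ u v, u ≠ v → t ≤ #(bichromaticCenters C u v)) :
    (t : ℝ) ≤ (1 - 1 / (Fintype.card K : ℝ)) * (Fintype.card V - 1) := by
  have hV : (1 : ℝ) < Fintype.card V := Nat.one_lt_cast.2 Fintype.one_lt_card
  have hlower : (Fintype.card V * (Fintype.card V - 1) * t : ℝ) ≤
      ∑ p ∈ (univ : Finset V).offDiag, (#(bichromaticCenters C p.1 p.2) : ℝ) := by
    rw [← cast_card_offDiag_univ, ← nsmul_eq_mul]
    exact card_nsmul_le_sum _ _ _ fun p hp => Nat.cast_le.2 (h _ _ (mem_offDiag.1 hp).2.2)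
  have hpos : (0 : ℝ) < Fintype.card V * (Fintype.card V - 1) := by
    have : (0 : ℝ) < Fintype.card V - 1 := sub_pos.2 hV
    positivity
  refine le_of_mul_le_mul_left ?_ hpos
  linarith [hlower.trans (sum_card_bichromaticCenters_le C)]

end BichromaticCenters

section Achievable

variable {V : Type*} [Fintype V] [Nontrivial V] {r l t : ℕ}

theorem mul_le_card_of_mem_achievable {G : SimpleGraph V}
    (ht : t ∈ achievable r l G) : t * (l - 1) ≤ Fintype.card V := by
  classical
  obtain ⟨c, hc⟩ := ht
  obtain ⟨u, v, huv⟩ := exists_pair_ne V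
  exact (hc u v huv).mul_le_card huv fun _ _ _ => subset_univ _

theorem le_of_mem_achievable_two (ht : t ∈ achievable r 2 (⊤ : SimpleGraph V)) :
    (t : ℝ) ≤ (1 - 1 / (r : ℝ)) * (Fintype.card V - 1) := by
  classical
  obtain ⟨c, hc⟩ := ht
  obtain ⟨u, v, huv⟩ := exists_pair_ne V
  have : Nonempty (Fin r) := ⟨c.get u v huv⟩
  obtain ⟨C, rfl⟩ := exists_labelingOfSym2_eq c
  simpa using le_of_forall_le_card_bichromaticCenters fun u v huv =>
    (hc u v huv).le_card_bichromaticCenters huv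

end Achievable

section Balanced

variable {V K : Type*} [Fintype V] [DecidableEq V] [DecidableEq K]

/-- The vertices outside `u`, `v` joined to `u` in color `i` and to `v` in color `j`. -/
def commonNbrs (C : Sym2 V → K) (u v : V) (i j : K) : Finset V :=
  {w | (w ≠ u ∧ w ≠ v) ∧ C s(u, w) = i ∧ C s(v, w) = j}

/-- A coloring of the pairs of vertices in which every joint color class of two vertices has,
up to an error `δ` in the density, at least the size expected for a uniformly random coloring. -/
def IsBalanced [Fintype K] (C : Sym2 V → K) (δ : ℝ) : Prop :=
  ∀ u v, u ≠ v → ∀ i j,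
    (1 / (Fintype.card K : ℝ) ^ 2 - δ) * Fintype.card V ≤ #(commonNbrs C u v i j)

variable [Fintype K] {C : Sym2 V → K} {δ : ℝ}

theorem IsBalanced.le_card_bichromaticCenters [Nonempty K] (hC : IsBalanced C δ) (hδ : 0 ≤ δ)
    {u v : V} (huv : u ≠ v) :
    (1 - 1 / (Fintype.card K : ℝ) - Fintype.card K ^ 2 * δ) * Fintype.card V ≤
      #(bichromaticCenters C u v) := by
  set k := (Fintype.card K : ℝ)
  have hk0 : 0 < k := Nat.cast_pos.2 Fintype.card_pos
  have hdisjoint : Set.PairwiseDisjoint ((univ : Finset K).offDiag : Set (K × K))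
      fun q => commonNbrs C u v q.1 q.2 := fun q _ q' _ hne => by
    refine Finset.disjoint_left.2 fun w hw hw' => hne ?_
    simp only [commonNbrs, mem_filter] at hw hw'
    exact Prod.ext (hw.2.2.1.symm.trans hw'.2.2.1) (hw.2.2.2.symm.trans hw'.2.2.2)
  have hunion : bichromaticCenters C u v =
      (univ : Finset K).offDiag.biUnion fun q => commonNbrs C u v q.1 q.2 := by
    ext w
    simp only [bichromaticCenters, commonNbrs, mem_filter, mem_univ, true_and, mem_biUnion,
      mem_offDiag]
    constructor
    · exact fun ⟨hends, hne⟩ => ⟨(_, _), hne, hends, rfl, rfl⟩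
    · rintro ⟨q, hne, hends, h₁, h₂⟩
      exact ⟨hends, by rwa [h₁, h₂]⟩
  calc
    _ ≤ k * (k - 1) * ((1 / k ^ 2 - δ) * Fintype.card V) := by
      have : 0 ≤ k * δ * Fintype.card V := by positivity
      field_simp
      nlinarith
    _ ≤ ∑ q ∈ (univ : Finset K).offDiag, (#(commonNbrs C u v q.1 q.2) : ℝ) := by
      rw [← cast_card_offDiag_univ, ← nsmul_eq_mul]
      exact card_nsmul_le_sum _ _ _ fun q _ => hC u v huv q.1 q.2
    _ = #(bichromaticCenters C u v) := by
      rw [hunion, card_biUnion hdisjoint, Nat.cast_sum]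

end Balanced

section Probability

open MeasureTheory ProbabilityTheory

variable {Ω : Type*} [MeasurableSpace Ω] {μ : Measure Ω}

theorem iIndepSet_iInter_preimage {I J K : Type*} [Finite J] [MeasurableSpace K]
    {X : I × J → Ω → K} (hX : ∀ e, Measurable (X e)) (hind : iIndepFun X μ)
    {S : I × J → Set K} (hS : ∀ e, MeasurableSet (S e)) :
    iIndepSet (fun i => ⋂ j, X (i, j) ⁻¹' S (i, j)) μ := by
  cases nonempty_fintype J
  rw [iIndepSet_iff_meas_biInter fun i => .iInter fun j => hX (i, j) (hS (i, j))]
  intro s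
  have hblock (s : Finset I) : μ (⋂ i ∈ s, ⋂ j, X (i, j) ⁻¹' S (i, j)) =
      ∏ i ∈ s, ∏ j, μ (X (i, j) ⁻¹' S (i, j)) := by
    rw [← prod_product', ← hind.meas_biInter fun e _ => ⟨S e, hS e, rfl⟩]
    congr 1
    ext ω
    simp only [Set.mem_iInter, mem_product, mem_univ, and_true, Prod.forall]
    exact forall_congr' fun i => forall_comm
  have hsingle (i : I) : μ (⋂ j, X (i, j) ⁻¹' S (i, j)) = ∏ j, μ (X (i, j) ⁻¹' S (i, j)) := by
    simpa using hblock {i}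
  rw [hblock, prod_congr rfl fun i _ => (hsingle i).symm]

theorem measureReal_card_le_exp [IsProbabilityMeasure μ] {W : Type*} [Fintype W] {E : W → Set Ω}
    [∀ ω, DecidablePred (ω ∈ E ·)] (hE : ∀ w, MeasurableSet (E w)) (hind : iIndepSet E μ) {p ε : ℝ}
    (hp : ∀ w, μ.real (E w) = p) (hε : 0 ≤ ε) :
    μ.real {ω | (#{w | ω ∈ E w} : ℝ) ≤ (p - ε) * Fintype.card W} ≤
      Real.exp (-(2 * ε ^ 2 * Fintype.card W)) := by
  let X (w : W) (ω : Ω) : ℝ := p - (E w).indicator 1 ω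
  have hind' : iIndepFun X μ :=
    (hind.iIndepFun_indicator (β := ℝ)).comp (fun _ x => p - x) fun _ => by fun_prop
  have hmeas (w) : Measurable ((E w).indicator (1 : Ω → ℝ)) := measurable_one.indicator (hE w)
  have hsubG (w) : HasSubgaussianMGF (X w) ((‖p - (p - 1)‖₊ / 2) ^ 2) μ := by
    refine hasSubgaussianMGF_of_mem_Icc_of_integral_eq_zero (by fun_prop)
      (.of_forall fun ω => ?_) ?_
    · by_cases h : ω ∈ E w <;> simp [X, h]
    · have hint : Integrable ((E w).indicator (1 : Ω → ℝ)) μ :=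
        (integrable_const 1).indicator (hE w)
      rw [integral_sub (integrable_const p) hint, integral_indicator_one (hE w), hp]
      simp
  have hsum (ω) : ∑ w, X w ω = p * Fintype.card W - #{w | ω ∈ E w} := by
    simp [X, Set.indicator_apply, mul_comm]
  calc
    _ = μ.real {ω | ε * Fintype.card W ≤ ∑ w, X w ω} := by
      congr with ω
      rw [hsum]
      grind
    _ ≤ _ := HasSubgaussianMGF.measure_sum_ge_le_of_iIndepFun hind' (fun w _ => hsubG w)
      (by positivity)
    _ = _ := by
      rcases eq_or_ne (Fintype.card W) 0 with h | _
      · simp [h]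
      · rw [sum_const, card_univ, nsmul_eq_mul, sub_sub_cancel, nnnorm_one]
        push_cast
        field_simp

end Probability

section RandomColoring

open MeasureTheory ProbabilityTheory

variable (E K : Type*) [Fintype E] [MeasurableSpace K]

/-- The distribution of a coloring of `E` whose colors are independent and uniform on `K`. -/
noncomputable def uniformColoring : Measure (E → K) :=
  .pi fun _ => uniformOn Set.univ

variable {E K} [MeasurableSingletonClass K] [Nonempty K]

instance isProbabilityMeasure_uniformOn_univ [Finite K] :
    IsProbabilityMeasure (uniformOn (Set.univ : Set K)) :=
  isProbabilityMeasure_uniformOn Set.finite_univ Set.univ_nonempty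

instance isProbabilityMeasure_uniformColoring [Finite K] :
    IsProbabilityMeasure (uniformColoring E K) := by
  unfold uniformColoring
  infer_instance

theorem iIndepFun_uniformColoring [Finite K] {J : Type*} {φ : J → E} (hφ : φ.Injective) :
    iIndepFun (fun j C => C (φ j)) (uniformColoring E K) :=
  (iIndepFun_pi fun _ => aemeasurable_id).precomp hφ

variable [Fintype K]

theorem measureReal_uniformColoring_iInter {J : Type*} [Fintype J] {φ : J → E} (hφ : φ.Injective)
    (a : J → K) :
    (uniformColoring E K).real (⋂ j, (fun C => C (φ j)) ⁻¹' {a j}) =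
      (1 / (Fintype.card K : ℝ)) ^ Fintype.card J := by
  have hsingle (j : J) :
      uniformColoring E K ((fun C => C (φ j)) ⁻¹' {a j}) = 1 / Fintype.card K := by
    have h := (measurePreserving_eval (fun _ : E => uniformOn (Set.univ : Set K))
      (φ j)).measure_preimage (measurableSet_singleton (a j)).nullMeasurableSet
    rwa [uniformOn_univ, Measure.count_singleton] at h
  rw [measureReal_def, (iIndepFun_uniformColoring hφ).meas_iInter
    fun j => ⟨{a j}, measurableSet_singleton _, rfl⟩]
  simp [hsingle]

variable {V : Type*} [Fintype V] [DecidableEq V] [DecidableEq K]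

theorem card_subtype_ne_and_ne {u v : V} (huv : u ≠ v) :
    Fintype.card {w : V // w ≠ u ∧ w ≠ v} + 2 = Fintype.card V := by
  have h : ({w : V | w ≠ u ∧ w ≠ v} : Finset V) = {u, v}ᶜ := by
    ext
    simp
  rw [Fintype.card_subtype, h, ← card_pair huv, card_compl_add_card]

theorem measureReal_card_commonNbrs_le_exp {u v : V} (huv : u ≠ v) (i j : K) {ε : ℝ} (hε : 0 ≤ ε) :
    (uniformColoring (Sym2 V) K).real
        {C | (#(commonNbrs C u v i j) : ℝ) ≤
          (1 / (Fintype.card K : ℝ) ^ 2 - ε) * (Fintype.card V - 2)} ≤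
      Real.exp (-(2 * ε ^ 2 * (Fintype.card V - 2))) := by
  classical
  let W := {w : V // w ≠ u ∧ w ≠ v}
  let φ : W × Bool → Sym2 V := fun e => s(bif e.2 then u else v, e.1)
  have hφ : φ.Injective := by
    rintro ⟨⟨w, hw⟩, b⟩ ⟨⟨w', hw'⟩, b'⟩ h
    simp only [φ, Sym2.eq_iff] at h
    cases b <;> cases b' <;> grind
  let a (b : Bool) : K := bif b then i else j
  let E (w : W) : Set (Sym2 V → K) := ⋂ b, (fun C => C (φ (w, b))) ⁻¹' {a b}
  have hE (w) : MeasurableSet (E w) :=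
    .iInter fun b => measurable_pi_apply _ (measurableSet_singleton _)
  have hind : iIndepSet E (uniformColoring (Sym2 V) K) :=
    iIndepSet_iInter_preimage (fun e => measurable_pi_apply (φ e)) (iIndepFun_uniformColoring hφ)
      (S := fun e => {a e.2}) fun e => measurableSet_singleton _
  have hp (w) := measureReal_uniformColoring_iInter (hφ.comp (Prod.mk_right_injective w)) a
  have hW : (Fintype.card V : ℝ) - 2 = Fintype.card W := by
    rw [← card_subtype_ne_and_ne huv]
    simp [W]
  have hcommon (C) : #(commonNbrs C u v i j) = #{w : W | C ∈ E w} := by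
    have hne : ∀ w ∈ commonNbrs C u v i j, w ≠ u ∧ w ≠ v := fun w hw => (mem_filter.1 hw).2.1
    rw [← filter_true_of_mem hne, ← card_subtype]
    congr with w
    simp [commonNbrs, E, φ, a, w.2, and_comm]
  simpa [hW, hcommon] using measureReal_card_le_exp hE hind hp hε

theorem exists_forall_lt_card_commonNbrs {ε : ℝ} (hε : 0 ≤ ε)
    (hlt : (Fintype.card V * Fintype.card K : ℝ) ^ 2 *
      Real.exp (-(2 * ε ^ 2 * (Fintype.card V - 2))) < 1) :
    ∃ C : Sym2 V → K, ∀ u v, u ≠ v → ∀ i j,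
      (1 / (Fintype.card K : ℝ) ^ 2 - ε) * (Fintype.card V - 2) < #(commonNbrs C u v i j) := by
  let bad (q : (V × V) × K × K) : Set (Sym2 V → K) :=
    {C | (#(commonNbrs C q.1.1 q.1.2 q.2.1 q.2.2) : ℝ) ≤
      (1 / (Fintype.card K : ℝ) ^ 2 - ε) * (Fintype.card V - 2)}
  let pairs : Finset ((V × V) × K × K) := univ.offDiag ×ˢ univ
  have hbad : ∀ q ∈ pairs, (uniformColoring (Sym2 V) K).real (bad q) ≤
      Real.exp (-(2 * ε ^ 2 * (Fintype.card V - 2))) := fun q hq =>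
    measureReal_card_commonNbrs_le_exp (mem_offDiag.1 (mem_product.1 hq).1).2.2 _ _ hε
  have hpairs : #pairs ≤ (Fintype.card V * Fintype.card K) ^ 2 := by
    refine (card_le_univ pairs).trans_eq ?_
    simp only [Fintype.card_prod]
    ring
  have hunion : (uniformColoring (Sym2 V) K).real (⋃ q ∈ pairs, bad q) < 1 :=
    calc
      _ ≤ ∑ q ∈ pairs, (uniformColoring (Sym2 V) K).real (bad q) :=
        measureReal_biUnion_finset_le _ _
      _ ≤ #pairs * Real.exp (-(2 * ε ^ 2 * (Fintype.card V - 2))) := by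
        simpa using sum_le_card_nsmul _ _ _ hbad
      _ ≤ _ := by
        gcongr
        exact_mod_cast hpairs
      _ < 1 := hlt
  obtain ⟨C, hC⟩ : ∃ C, C ∉ ⋃ q ∈ pairs, bad q := by
    by_contra! h
    simp [Set.eq_univ_of_forall h] at hunion
  refine ⟨C, fun u v huv i j => ?_⟩
  by_contra! h
  exact hC (Set.mem_biUnion (x := ((u, v), i, j)) (by simp [pairs, huv]) h)

theorem exists_isBalanced_of_lt {δ : ℝ} (hδ : 0 < δ) (hV : 4 ≤ δ * Fintype.card V)
    (hlt : (Fintype.card V * Fintype.card K : ℝ) ^ 2 *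
      Real.exp (-(δ ^ 2 / 2 * (Fintype.card V - 2))) < 1) :
    ∃ C : Sym2 V → K, IsBalanced C δ := by
  obtain ⟨C, hC⟩ := exists_forall_lt_card_commonNbrs (V := V) (K := K) (half_pos hδ).le
    (by convert hlt using 5; ring)
  refine ⟨C, fun u v huv i j => (hC u v huv i j).le.trans' ?_⟩
  have hK : (1 : ℝ) ≤ Fintype.card K ^ 2 := one_le_pow₀ (Nat.one_le_cast.2 Fintype.card_pos)
  have hK' : 1 / (Fintype.card K : ℝ) ^ 2 ≤ 1 := div_le_one_of_le₀ hK (by positivity)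
  linarith

open Filter Topology in
theorem eventually_exists_isBalanced (K : Type*) [Fintype K] [DecidableEq K] [Nonempty K] {δ : ℝ}
    (hδ : 0 < δ) : ∀ᶠ n : ℕ in atTop, ∃ C : Sym2 (Fin n) → K, IsBalanced C δ := by
  let _ : MeasurableSpace K := ⊤
  have hlim : Tendsto (fun n : ℕ => (n * Fintype.card K : ℝ) ^ 2 *
      Real.exp (-(δ ^ 2 / 2 * (n - 2)))) atTop (𝓝 0) := by
    have h := (tendsto_pow_const_mul_const_pow_of_lt_one 2 (Real.exp_nonneg (-(δ ^ 2 / 2)))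
      (Real.exp_lt_one_iff.2 (neg_neg_of_pos (by positivity)))).const_mul
        ((Fintype.card K : ℝ) ^ 2 * Real.exp (δ ^ 2))
    rw [mul_zero] at h
    refine h.congr fun n => ?_
    rw [← Real.exp_nat_mul, mul_mul_mul_comm, ← mul_pow, ← Real.exp_add]
    ring_nf
  filter_upwards [hlim.eventually_lt_const one_pos,
    (tendsto_natCast_atTop_atTop.const_mul_atTop hδ).eventually_ge_atTop 4] with n hlt hge
  exact exists_isBalanced_of_lt hδ (by simpa using hge) (by simpa using hlt)

end RandomColoring

section ColorDense

variable {V : Type*} [Fintype V] [DecidableEq V]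

/-- The `±1`-valued indicator of the color `a`. -/
def colorSign (a b : Bool) : ℝ :=
  if b = a then 1 else -1

variable {C : Sym2 V → Bool} {δ : ℝ}

theorem colorSign_mul_colorSign (a b c : Bool) :
    colorSign a b * colorSign a c = 1 - 2 * if b ≠ c then 1 else 0 := by
  cases a <;> cases b <;> cases c <;> norm_num [colorSign]

theorem IsBalanced.sum_colorSign_mul_colorSign_le (hC : IsBalanced C δ) (hδ : 0 ≤ δ) (a : Bool)
    (x y : V) :
    ∑ w, colorSign a (C s(x, w)) * colorSign a (C s(y, w)) ≤
      (if x = y then (Fintype.card V : ℝ) else 0) + 8 * δ * Fintype.card V := by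
  have hsum : ∑ w, colorSign a (C s(x, w)) * colorSign a (C s(y, w)) =
      Fintype.card V - 2 * #{w | C s(x, w) ≠ C s(y, w)} := by
    simp_rw [colorSign_mul_colorSign]
    rw [sum_sub_distrib, ← mul_sum, sum_boole]
    simp
  rw [hsum]
  have hδV : 0 ≤ 8 * δ * Fintype.card V := by positivity
  split_ifs with hxy
  · subst hxy
    simpa using hδV
  · have hbound := hC.le_card_bichromaticCenters hδ hxy
    have hle : (#(bichromaticCenters C x y) : ℝ) ≤ #{w | C s(x, w) ≠ C s(y, w)} :=
      Nat.cast_le.2 (card_le_card (monotone_filter_right _ fun _ _ h => h.2))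
    rw [Fintype.card_bool] at hbound
    norm_num at hbound
    linarith

theorem IsBalanced.card_mul_card_le (hC : IsBalanced C δ) (hδ : 0 ≤ δ)
    {X Y : Finset V} {a : Bool} (hXY : ∀ x ∈ X, ∀ y ∈ Y, C s(x, y) ≠ a) :
    (#X * #Y : ℝ) ≤ Fintype.card V + 8 * δ * Fintype.card V * #X := by
  -- Second moment of the signed degrees `∑ x ∈ X, σ x w`, which equal `-#X` for `w ∈ Y`.
  let σ (x w : V) : ℝ := colorSign a (C s(x, w))
  rcases X.eq_empty_or_nonempty with rfl | hX
  · simp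
  have hX0 : (0 : ℝ) < #X := Nat.cast_pos.2 hX.card_pos
  refine le_of_mul_le_mul_left ?_ hX0
  calc
    #X * (#X * #Y : ℝ) = ∑ w ∈ Y, (∑ x ∈ X, σ x w) ^ 2 := by
      have (w) (hw : w ∈ Y) : ∑ x ∈ X, σ x w = -#X := by
        have hσ : ∀ x ∈ X, σ x w = -1 := fun x hx => if_neg (hXY x hx w hw)
        rw [sum_congr rfl hσ, sum_const, nsmul_eq_mul, mul_neg_one]
      rw [sum_congr rfl fun w hw => by rw [this w hw], sum_const, nsmul_eq_mul]
      ring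
    _ ≤ ∑ w, (∑ x ∈ X, σ x w) ^ 2 :=
      sum_le_univ_sum_of_nonneg fun w => sq_nonneg _
    _ = ∑ x ∈ X, ∑ x' ∈ X, ∑ w, σ x w * σ x' w := by
      simp_rw [sq, sum_mul_sum]
      rw [sum_comm]
      exact sum_congr rfl fun x _ => sum_comm
    _ ≤ ∑ x ∈ X, ∑ x' ∈ X,
        ((if x = x' then (Fintype.card V : ℝ) else 0) + 8 * δ * Fintype.card V) :=
      sum_le_sum fun x _ => sum_le_sum fun x' _ => hC.sum_colorSign_mul_colorSign_le hδ a x x'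
    _ = #X * (Fintype.card V + 8 * δ * Fintype.card V * #X) := by
      simp only [sum_add_distrib, sum_ite_eq, sum_ite_mem, inter_self, sum_const, nsmul_eq_mul]
      ring

/-- Any two sets of more than `m` vertices are joined by edges of every color. The sets may overlap,
in which case the value of `C` on the diagonal counts as well. -/
def IsColorDense {V K : Type*} (C : Sym2 V → K) (m : ℕ) : Prop :=
  ∀ X Y : Finset V, m < #X → m < #Y → ∀ a, ∃ x ∈ X, ∃ y ∈ Y, C s(x, y) = a

theorem IsBalanced.isColorDense {η : ℝ} (hC : IsBalanced C (η / 16))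
    (hη : 0 ≤ η) (hV : 2 ≤ η ^ 2 * Fintype.card V) : IsColorDense C ⌊η * Fintype.card V⌋₊ := by
  intro X Y hX hY a
  by_contra! h
  have hX' := (Nat.floor_lt (by positivity)).1 hX
  have hY' := (Nat.floor_lt (by positivity)).1 hY
  have hle := hC.card_mul_card_le (by positivity) h
  have hη0 : 0 < η := hη.lt_of_ne' fun h0 => by norm_num [h0] at hV
  have hX0 : (0 : ℝ) < #X := hX'.trans_le' (by positivity)
  have hηX : η * (η * Fintype.card V) < η * #X := by gcongr
  have hXY : η * Fintype.card V * #X < #Y * #X := by gcongr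
  have hV0 : (0 : ℝ) < Fintype.card V := pos_of_mul_pos_right (by linarith) (sq_nonneg η)
  have hηX2 : η * #X < 2 := by
    refine lt_of_mul_lt_mul_left ?_ hV0.le
    linarith
  linarith

end ColorDense

section Greedy

variable {V K : Type*} {C : Sym2 V → K} {m : ℕ}

theorem IsColorDense.exists_sequence (hC : IsColorDense C m) {d : ℕ} {X : Fin (d + 1) → Finset V}
    (a : Fin d → K) (hX₀ : m < #(X 0)) (hX : ∀ i : Fin d, 2 * m < #(X i.succ)) :
    ∃ x : Fin (d + 1) → V, (∀ i, x i ∈ X i) ∧ ∀ i, C s(x i.castSucc, x i.succ) = a i := by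
  induction d with
  | zero =>
    obtain ⟨x, hx⟩ := card_pos.1 (Nat.zero_lt_of_lt hX₀)
    exact ⟨fun _ => x, Fin.cases hx fun i => i.elim0, fun i => i.elim0⟩
  | succ d ih =>
    classical
    let N : Finset V := {y ∈ X 1 | ∃ z ∈ X 0, C s(z, y) = a 0}
    have hN : m < #N := by
      by_contra! hN
      have hlarge : m < #(X 1 \ N) := by
        have := hX 0
        have := le_card_sdiff N (X 1)
        rw [Fin.succ_zero_eq_one] at *
        omega
      obtain ⟨z, hz, y, hy, hzy⟩ := hC _ _ hX₀ hlarge (a 0)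
      obtain ⟨hy, hyN⟩ := mem_sdiff.1 hy
      exact hyN (mem_filter.2 ⟨hy, z, hz, hzy⟩)
    obtain ⟨x, hx, hcolor⟩ := ih (X := Fin.cons N fun i => X i.succ.succ) (fun i => a i.succ)
      hN fun i => hX i.succ
    obtain ⟨hx₁, z, hz, hzx⟩ := mem_filter.1 (hx 0)
    refine ⟨Fin.cons z x, Fin.cases hz (Fin.cases hx₁ fun i => hx i.succ), Fin.cases hzx hcolor⟩

/-- Sequences are removed one at a time; the slack `2 * m` in the size of the sets survives. -/
theorem IsColorDense.exists_disjoint_sequences (hC : IsColorDense C m) {d s : ℕ}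
    {X : Fin (d + 1) → Finset V} (a : Fin d → K) (hX : ∀ i, s + 2 * m ≤ #(X i)) :
    ∃ x : Fin s → Fin (d + 1) → V, (∀ j i, x j i ∈ X i) ∧
      (∀ j i, C s(x j i.castSucc, x j i.succ) = a i) ∧ ∀ i, (fun j => x j i).Injective := by
  classical
  induction s generalizing X with
  | zero => exact ⟨fun j => j.elim0, fun j => j.elim0, fun j => j.elim0, fun i j => j.elim0⟩
  | succ s ih =>
    obtain ⟨y, hy, hcolor⟩ := hC.exists_sequence a (X := X) (by have := hX 0; omega)
      fun i => by have := hX i.succ; omega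
    obtain ⟨x, hx, hxcolor, hinj⟩ := ih (X := fun i => (X i).erase (y i)) fun i => by
      have := hX i
      rw [card_erase_of_mem (hy i)]
      omega
    refine ⟨Fin.cons y x, Fin.cases hy fun j i => mem_of_mem_erase (hx j i),
      Fin.cases hcolor hxcolor, fun i => ?_⟩
    have : (fun j => (Fin.cons y x : Fin (s + 1) → Fin (d + 1) → V) j i) =
        Fin.cons (y i) fun j => x j i := by
      ext j
      cases j using Fin.cases <;> rfl
    rw [this, Fin.cons_injective_iff]
    refine ⟨?_, hinj i⟩
    rintro ⟨j, hj⟩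
    exact (ne_of_mem_erase (hx j i)) hj

theorem exists_pairwise_disjoint_subsets {S T : Finset V} (hTS : T ⊆ S) {d s : ℕ}
    (hT : s ≤ #T) (hS : (d + 1) * s ≤ #S) :
    ∃ X : Fin (d + 1) → Finset V, (∀ i, X i ⊆ S) ∧ (∀ i, #(X i) = s) ∧ X (Fin.last d) ⊆ T ∧
      Pairwise fun i j => Disjoint (X i) (X j) := by
  classical
  induction d generalizing S T with
  | zero =>
    obtain ⟨T', hT', rfl⟩ := exists_subset_card_eq hT
    exact ⟨fun _ => T', fun _ => hT'.trans hTS, fun _ => rfl, hT', fun i j hij =>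
      absurd (Subsingleton.elim (α := Fin 1) i j) hij⟩
  | succ d ih =>
    obtain ⟨T', hT', hcard'⟩ := exists_subset_card_eq hT
    have hle : s ≤ #(S \ T') := by
      rw [card_sdiff_of_subset (hT'.trans hTS)]
      lia
    obtain ⟨A, hA, hcardA⟩ := exists_subset_card_eq hle
    obtain ⟨hAS, hAT'⟩ := subset_sdiff.1 hA
    obtain ⟨X, hXS, hX, hlast, hdisjoint⟩ := ih (S := S \ A) (T := T')
      (subset_sdiff.2 ⟨hT'.trans hTS, hAT'.symm⟩) hcard'.ge (by
        rw [card_sdiff_of_subset hAS]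
        lia)
    have hXA (i) : Disjoint (X i) A := (subset_sdiff.1 (hXS i)).2
    refine ⟨Fin.cons A X, Fin.cases hAS fun i => (hXS i).trans sdiff_subset,
      Fin.cases hcardA hX, hlast.trans hT', ?_⟩
    refine Fin.cases (Fin.cases (absurd rfl) fun j _ => (hXA j).symm) fun i => ?_
    exact Fin.cases (fun _ => hXA i) fun j hij => hdisjoint (ne_of_apply_ne _ hij)

theorem color_withEnds {d : ℕ} {u v : V} {x : Fin (d + 1) → V} {a : ℕ → K}
    (hu : C s(u, x 0) = a 0) (hx : ∀ i : Fin d, C s(x i.castSucc, x i.succ) = a (i + 1))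
    (hv : C s(v, x (Fin.last d)) = a (d + 1)) (e : Fin (d + 2)) :
    C s(withEnds u v x e.castSucc, withEnds u v x e.succ) = a e := by
  have hsucc (i : Fin (d + 1)) : withEnds u v x i.succ.castSucc = x i :=
    Fin.snoc_castSucc (α := fun _ => V) _ _ i
  have hlast : withEnds u v x (Fin.last (d + 2)) = v := Fin.snoc_last (α := fun _ => V) _ _
  cases e using Fin.cases with
  | zero => exact hu
  | succ e =>
    cases e using Fin.lastCases with
    | last => rwa [hsucc, Fin.succ_last, Fin.succ_last, hlast, Sym2.eq_swap]
    | cast i => rw [hsucc, Fin.succ_castSucc, Fin.succ_castSucc, hsucc, hx, Fin.val_castSucc,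
        Fin.val_succ]

end Greedy

section AlternatingPaths

variable {V : Type*} [Fintype V] [DecidableEq V] {C : Sym2 V → Bool} {m q s d : ℕ} {u v : V}

theorem card_commonNbrs_union {K : Type*} [DecidableEq K] {C : Sym2 V → K} (i : K) {j j' : K}
    (hj : j ≠ j') : #(commonNbrs C u v i j ∪ commonNbrs C u v i j') =
      #(commonNbrs C u v i j) + #(commonNbrs C u v i j') := by
  refine card_union_of_disjoint (Finset.disjoint_left.2 fun w hw hw' => hj ?_)
  exact (mem_filter.1 hw).2.2.2.symm.trans (mem_filter.1 hw').2.2.2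

/-- The interior vertices lie in disjoint sets of neighbors of `u` in the first color `a`; only the
last set has to consist of neighbors of `v` in the color prescribed for the last edge. -/
theorem IsColorDense.exists_alternating (hC : IsColorDense C m) (hd : 1 ≤ d)
    (hq : ∀ i j, q ≤ #(commonNbrs C u v i j)) (hs : (d + 1) * (s + 2 * m) ≤ 2 * q) (a : Bool) :
    ∃ x : Fin s → Fin (d + 1) → V, (Function.uncurry x).Injective ∧
      (∀ j i, (x j i ≠ u ∧ x j i ≠ v) ∧ C s(u, x j i) = a) ∧
      ∀ j (e : Fin (d + 2)), C s(withEnds u v (x j) e.castSucc, withEnds u v (x j) e.succ) =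
        not^[e] a := by
  let S : Finset V := commonNbrs C u v a true ∪ commonNbrs C u v a false
  let T : Finset V := commonNbrs C u v a (not^[d + 1] a)
  have hS : ∀ w ∈ S, (w ≠ u ∧ w ≠ v) ∧ C s(u, w) = a := by
    simp only [S, commonNbrs, mem_union, mem_filter]
    grind
  have hTS : T ⊆ S := by
    cases h : not^[d + 1] a <;> simp only [S, T, h, subset_union_left, subset_union_right]
  obtain ⟨X, hXS, hX, hlast, hdisjoint⟩ := exists_pairwise_disjoint_subsets hTS
    (s := s + 2 * m) (d := d) (by have := hq a (not^[d + 1] a); nlinarith) (by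
      rw [card_commonNbrs_union a (by decide)]
      linarith [hq a true, hq a false])
  obtain ⟨x, hx, hcolor, hinj⟩ := hC.exists_disjoint_sequences (fun i : Fin d => not^[i + 1] a)
    fun i => (hX i).ge
  refine ⟨x, ?_, fun j i => hS _ (hXS i (hx j i)), fun j => color_withEnds (a := (not^[·] a))
    (hS _ (hXS 0 (hx j 0))).2 (hcolor j) (mem_filter.1 (hlast (hx j (Fin.last d)))).2.2.2⟩
  rintro ⟨j, i⟩ ⟨j', i'⟩ (h : x j i = x j' i')
  obtain rfl : i = i' := by
    by_contra hne
    exact Finset.disjoint_left.1 (hdisjoint hne) (hx j i) (h ▸ hx j' i')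
  rw [hinj i h]

theorem IsColorDense.connectedBy (hC : IsColorDense C m) (hd : 1 ≤ d) (huv : u ≠ v)
    (hq : ∀ i j, q ≤ #(commonNbrs C u v i j)) (hs : (d + 1) * (s + 2 * m) ≤ 2 * q) :
    ConnectedBy (labelingOfSym2 ⊤ C) (d + 2) (2 * s) u v := by
  choose x hinj hx hcolor using hC.exists_alternating hd hq hs
  have hcard : 2 * s = Fintype.card (Bool × Fin s) := by simp
  rw [hcard]
  refine connectedBy_of_injective (x := fun p => x p.1 p.2) huv ?_ ?_ ?_ ?_
  · rintro ⟨⟨a, j⟩, i⟩ ⟨⟨a', j'⟩, i'⟩ (h : x a j i = x a' j' i')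
    obtain rfl : a = a' := by rw [← (hx a j i).2, h, (hx a' j' i').2]
    obtain ⟨rfl, rfl⟩ := Prod.mk.inj (@hinj a (j, i) (j', i') h)
    rfl
  · rintro p ⟨i, h⟩
    exact (hx p.1 p.2 i).1.1 h
  · rintro p ⟨i, h⟩
    exact (hx p.1 p.2 i).1.2 h
  · intro p i
    rw [hcolor, hcolor, Fin.val_castSucc, Fin.val_succ, Function.iterate_succ_apply']
    exact (Bool.not_ne_self _).symm

end AlternatingPaths

section Asymptotics

open Filter Topology

theorem isEquivalent_const_mul_of_bounds {f : ℕ → ℝ} {a : ℝ} (ha : 0 < a)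
    (hupper : ∀ᶠ n : ℕ in atTop, f n ≤ a * n)
    (hlower : ∀ b, 0 < b → b < a → ∀ᶠ n : ℕ in atTop, b * n ≤ f n) :
    Asymptotics.IsEquivalent atTop f fun n => a * n := by
  have hpos : ∀ᶠ n : ℕ in atTop, 0 < a * n := by
    filter_upwards [eventually_gt_atTop 0] with n hn
    positivity
  rw [Asymptotics.isEquivalent_iff_tendsto_one (hpos.mono fun _ h => h.ne')]
  refine tendsto_order.2 ⟨fun b hb => ?_, fun b hb => ?_⟩
  · obtain ⟨c, hbc, hc⟩ := exists_between (max_lt hb one_pos)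
    obtain ⟨hbc, hc0⟩ := max_lt_iff.1 hbc
    filter_upwards [hpos, hlower (c * a) (by positivity) (mul_lt_of_lt_one_left ha hc)]
      with n hn h
    exact hbc.trans_le ((le_div_iff₀ hn).2 (by linarith))
  · filter_upwards [hpos, hupper] with n hn h
    exact ((div_le_one hn).2 h).trans_lt hb

theorem alternatingConnectivity_two_le (V : Type*) [Fintype V] [Nontrivial V] {r : ℕ}
    (hr : 1 ≤ r) : (alternatingConnectivity r 2 (⊤ : SimpleGraph V) : ℝ) ≤
      (1 - 1 / (r : ℝ)) * Fintype.card V := by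
  have hr' : 0 ≤ 1 - 1 / (r : ℝ) :=
    sub_nonneg.2 (div_le_one_of_le₀ (Nat.one_le_cast.2 hr) r.cast_nonneg)
  exact (le_of_mem_achievable_two (isGreatest_alternatingConnectivity hr 2 _).1).trans
    (mul_le_mul_of_nonneg_left (sub_le_self _ zero_le_one) hr')

theorem alternatingConnectivity_add_two_le {V : Type*} [Fintype V] [Nontrivial V] {r : ℕ}
    (hr : 1 ≤ r) (d : ℕ) (G : SimpleGraph V) :
    (alternatingConnectivity r (d + 2) G : ℝ) ≤ 1 / (d + 1) * Fintype.card V := by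
  have h := mul_le_card_of_mem_achievable (isGreatest_alternatingConnectivity hr (d + 2) G).1
  rw [one_div_mul_eq_div, le_div_iff₀ (by positivity)]
  exact_mod_cast h

theorem eventually_mul_le_alternatingConnectivity_two {r : ℕ} (hr : 1 ≤ r) {b : ℝ}
    (hb : b < 1 - 1 / (r : ℝ)) : ∀ᶠ n : ℕ in atTop,
      b * n ≤ alternatingConnectivity r 2 (⊤ : SimpleGraph (Fin n)) := by
  have : Nonempty (Fin r) := ⟨⟨0, hr⟩⟩
  have hδ : 0 < (1 - 1 / (r : ℝ) - b) / r ^ 2 := div_pos (sub_pos.2 hb) (by positivity)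
  filter_upwards [eventually_exists_isBalanced (Fin r) hδ, eventually_ge_atTop 2]
    with n ⟨C, hC⟩ hn
  have : Nontrivial (Fin n) := Fin.nontrivial_iff_two_le.2 hn
  have hcenters {u v : Fin n} (huv : u ≠ v) : ⌈b * n⌉₊ ≤ #(bichromaticCenters C u v) := by
    have h := hC.le_card_bichromaticCenters hδ.le huv
    rw [Fintype.card_fin, Fintype.card_fin, mul_div_cancel₀ _ (by positivity), sub_sub_cancel] at h
    exact Nat.ceil_le.2 h
  have hmem : ⌈b * n⌉₊ ∈ achievable r 2 (⊤ : SimpleGraph (Fin n)) :=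
    ⟨labelingOfSym2 ⊤ C, fun u v huv =>
      connectedBy_of_le_card_bichromaticCenters huv (hcenters huv)⟩
  exact (Nat.le_ceil _).trans
    (Nat.cast_le.2 ((isGreatest_alternatingConnectivity hr 2 _).2 hmem))

theorem IsBalanced.mem_achievable {V : Type*} [Fintype V] [DecidableEq V] {C : Sym2 V → Bool}
    {ε : ℝ} {d r : ℕ} (hd : 1 ≤ d) (hr : 2 ≤ r) (hε : 0 < ε) (hεd : ε ≤ 1 / (d + 1))
    (hC : IsBalanced C (ε / 128)) (hV : 128 ≤ ε ^ 2 * Fintype.card V) :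
    2 * ⌈(1 / (d + 1) - ε) / 2 * Fintype.card V⌉₊ ∈ achievable r (d + 2) (⊤ : SimpleGraph V) := by
  set n := (Fintype.card V : ℝ) with hn
  set s := ⌈(1 / (d + 1) - ε) / 2 * n⌉₊
  let m := ⌊ε / 8 * n⌋₊
  let q := ⌈(1 / 4 - ε / 128) * n⌉₊
  have hdense : IsColorDense C m :=
    IsBalanced.isColorDense (by convert hC using 1; ring) (by positivity) (by linarith)
  have hq {u v : V} (huv : u ≠ v) (i j : Bool) : q ≤ #(commonNbrs C u v i j) := by
    have hK : 1 / (Fintype.card Bool : ℝ) ^ 2 = 1 / 4 := by norm_num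
    exact Nat.ceil_le.2 (hK ▸ hC u v huv i j)
  have hd' : (1 : ℝ) ≤ d := Nat.one_le_cast.2 hd
  have hε1 : ε ≤ 1 := hεd.trans ((div_le_one (by positivity)).2 (by linarith))
  have hεn : 128 ≤ ε * n := by
    rw [sq, mul_assoc] at hV
    exact hV.trans (mul_le_of_le_one_left (by positivity) hε1)
  have hs : (d + 1) * (s + 2 * m) ≤ 2 * q := by
    have hs' : (s : ℝ) ≤ (1 / (d + 1) - ε) / 2 * n + 1 :=
      (Nat.ceil_lt_add_one (mul_nonneg (by linarith) (by positivity))).le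
    have hm : (m : ℝ) ≤ ε / 8 * n := Nat.floor_le (by positivity)
    have hq' : (1 / 4 - ε / 128) * n ≤ q := Nat.le_ceil _
    suffices h : ((d + 1) * (s + 2 * m) : ℝ) ≤ 2 * q from mod_cast h
    calc
      ((d + 1) * (s + 2 * m) : ℝ) ≤
          (d + 1) * ((1 / (d + 1) - ε) / 2 * n + 1 + 2 * (ε / 8 * n)) := by gcongr
      _ = n / 2 - (d + 1) * (ε * n / 4 - 1) := by
        field_simp
        ring
      _ ≤ n / 2 - 1 * (ε * n / 4 - 1) := by
        gcongr <;> linarith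
      _ ≤ 2 * q := by linarith
  refine mem_achievable_of_connectedBy (by rwa [Fintype.card_bool]) (labelingOfSym2 ⊤ C) ?_
  exact fun u v huv => hdense.connectedBy hd huv (hq huv) hs

theorem eventually_mul_le_alternatingConnectivity_add_two {r d : ℕ} (hr : 2 ≤ r) (hd : 1 ≤ d)
    {b : ℝ} (hb₀ : 0 < b) (hb : b < 1 / (d + 1)) : ∀ᶠ n : ℕ in atTop,
      b * n ≤ alternatingConnectivity r (d + 2) (⊤ : SimpleGraph (Fin n)) := by
  have hε : 0 < 1 / (d + 1) - b := sub_pos.2 hb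
  filter_upwards [eventually_exists_isBalanced Bool (div_pos hε (by norm_num : (0 : ℝ) < 128)),
    (tendsto_natCast_atTop_atTop.const_mul_atTop (pow_pos hε 2)).eventually_ge_atTop 128,
    eventually_ge_atTop 2] with n ⟨C, hC⟩ hn hn2
  have : Nontrivial (Fin n) := Fin.nontrivial_iff_two_le.2 hn2
  have hmem := hC.mem_achievable hd hr hε (by linarith) (by simpa using hn)
  rw [Fintype.card_fin, sub_sub_cancel] at hmem
  calc
    b * n = 2 * (b / 2 * n) := by ring
    _ ≤ (2 * ⌈b / 2 * n⌉₊ : ℕ) := by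
      push_cast
      gcongr
      exact Nat.le_ceil _
    _ ≤ _ := Nat.cast_le.2 ((isGreatest_alternatingConnectivity (by lia) _ _).2 hmem)

end Asymptotics

end AltConn

theorem theorem5p1 (r : ℕ) (hr : 2 ≤ r) :
    Asymptotics.IsEquivalent Filter.atTop
      (fun n : ℕ => (AltConn.alternatingConnectivity r 2 (⊤ : SimpleGraph (Fin n)) : ℝ))
      (fun n : ℕ => (1 - 1 / (r : ℝ)) * (n : ℝ)) ∧
    ∀ l : ℕ, 3 ≤ l →
      Asymptotics.IsEquivalent Filter.atTop
        (fun n : ℕ => (AltConn.alternatingConnectivity r l (⊤ : SimpleGraph (Fin n)) : ℝ))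
        (fun n : ℕ => (n : ℝ) / ((l : ℝ) - 1)) := by
  refine ⟨AltConn.isEquivalent_const_mul_of_bounds ?_ ?_ fun b _ hb =>
    AltConn.eventually_mul_le_alternatingConnectivity_two (by lia) hb, fun l hl => ?_⟩
  · have : (1 : ℝ) < r := Nat.one_lt_cast.2 hr
    exact sub_pos.2 ((div_lt_one (by linarith)).2 this)
  · filter_upwards [Filter.eventually_ge_atTop 2] with n hn
    have : Nontrivial (Fin n) := Fin.nontrivial_iff_two_le.2 hn
    simpa using AltConn.alternatingConnectivity_two_le (Fin n) (by lia : 1 ≤ r)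
  obtain ⟨d, rfl⟩ := Nat.exists_eq_add_of_le' (Nat.le_of_succ_le hl)
  have hmul (n : ℕ) : (n : ℝ) / ((d + 2 : ℕ) - 1) = 1 / (d + 1) * n := by
    push_cast
    ring
  simp_rw [hmul]
  refine AltConn.isEquivalent_const_mul_of_bounds (by positivity) ?_ fun b hb₀ hb =>
    AltConn.eventually_mul_le_alternatingConnectivity_add_two hr (by lia) hb₀ hb
  filter_upwards [Filter.eventually_ge_atTop 2] with n hn
  have : Nontrivial (Fin n) := Fin.nontrivial_iff_two_le.2 hn
  simpa using AltConn.alternatingConnectivity_add_two_le (V := Fin n) (by lia : 1 ≤ r) d ⊤
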